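/- Let $n\ge 1$. Let $\Lambda_W=\mathbb{Z}\{e_1,\dots,e_n\}/(e_1+\cdots+e_n=0)$ be the weight lattice of the root system $A_{n-1}$, viewed as the image of $\mathbb{Z}^n$ in the real vector space $V=\mathbb{R}^n/\mathbb{R}(1,\dots,1)$, and let $A=A_{n-1}=\{e_i-e_j : 1\le i<j\le n\}\subset\Lambda_W$ be its set of positive roots. For $B\subseteq A$ let $r(B)=\dim_{\mathbb{R}}\operatorname{span}B$, and let the multiplicity $m(B)$ be the index of $\mathbb{Z}B$ in $\operatorname{span}B\cap\Lambda_W$. Let $$M^W_{A}(x,y)=\sum_{B\subseteq A} m(B)\,(x-1)^{r(A)-r(B)}(y-1)^{|B|-r(B)}$$ be the arithmetic Tutte polynomial of $A_{n-1}$ in $\Lambda_W$, and let $$\chi^W_{A_{n-1}}(q)=(-1)^{r(A)}\,q^{\,\operatorname{rank}\Lambda_W-r(A)}\,M^W_{A}(1-q,0)$$ be its arithmetic characteristic polynomial (here $r(A)=\operatorname{rank}\Lambda_W=n-1$). Then, as polynomials in $q$, $$\chi^W_{A_{n-1}}(q)=\sum_{k=1}^{n}(-1)^{n-k}\,c_k\,q^{k-1},\qquad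 c_k=\sum_{\pi\in S_{n,k}}\gcd(\pi),$$ where $S_{n,k}$ is the set of permutations of $\{1,\dots,n\}$ with exactly $k$ cycles (fixed points counted as cycles of length $1$), and $\gcd(\pi)$ is the greatest common divisor of the lengths of the cycles of $\pi$. -/

import Mathlib

open scoped Polynomial

noncomputable section

namespace ArithTutte

section General

variable {V : Type*} [AddCommGroup V] [Module ℝ V] {ι : Type*}

/-- The rank `r(B) = dim span B` of the subconfiguration `B` of a vector configuration
`a : ι → V` (a finite indexed family of vectors of a real vector space). -/
def rank (a : ι → V) (B : Finset ι) : ℕ :=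
  Module.finrank ℝ (Submodule.span ℝ (a '' (B : Set ι)))

/-- The multiplicity `m(B)` of `B` with respect to the lattice `L ⊆ V`: the index of `ℤB` as a
sublattice of `span B ∩ L`. -/
def latticeMult (L : Submodule ℤ V) (a : ι → V) (B : Finset ι) : ℕ :=
  (Submodule.span ℤ (a '' (B : Set ι))).toAddSubgroup.relIndex
    ((Submodule.span ℝ (a '' (B : Set ι))).restrictScalars ℤ ⊓ L).toAddSubgroup

/-- The arithmetic Tutte polynomial
`M(x, y) = ∑_B m(B) (x - 1)^(r(A) - r(B)) (y - 1)^(|B| - r(B))`, the sum being over all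
subconfigurations `B` of `A`; the variable `x` is `X 0` and `y` is `X 1`. Neither of the natural
subtractions truncates, because `r(B) ≤ r(A)` and `r(B) ≤ |B|`. -/
def tutte [Fintype ι] (L : Submodule ℤ V) (a : ι → V) : MvPolynomial (Fin 2) ℤ :=
  ∑ B : Finset ι, (latticeMult L a B : MvPolynomial (Fin 2) ℤ) *
    (MvPolynomial.X 0 - 1) ^ (rank a Finset.univ - rank a B) *
    (MvPolynomial.X 1 - 1) ^ (B.card - rank a B)

/-- The arithmetic characteristic polynomial `χ(q) = (-1)^r q^(N - r) M(1 - q, 0)`, where `N` is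
the rank of the lattice `L` and `r` the rank of the configuration; the variable `q` is `X`. -/
def charPoly [Fintype ι] (L : Submodule ℤ V) (a : ι → V) : ℤ[X] :=
  (-1) ^ rank a Finset.univ * Polynomial.X ^ (Module.finrank ℤ L - rank a Finset.univ) *
    MvPolynomial.aeval ![1 - Polynomial.X, 0] (tutte L a)

end General

/-- The ambient real vector space `ℝⁿ / ℝ(1, …, 1)` of the weight lattice of `A_{n-1}`. -/
abbrev WeightSpace (n : ℕ) : Type :=
  (Fin n → ℝ) ⧸ Submodule.span ℝ {(fun _ => 1 : Fin n → ℝ)}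

/-- The image in `ℝⁿ / ℝ(1, …, 1)` of the standard basis vector `e_i`. -/
def e {n : ℕ} (i : Fin n) : WeightSpace n :=
  Submodule.Quotient.mk (Pi.single i 1)

/-- The weight lattice `Λ_W(A_{n-1}) = ℤ{e_1, …, e_n} / (∑ e_i = 0)`. -/
def weightLattice (n : ℕ) : Submodule ℤ (WeightSpace n) :=
  Submodule.span ℤ (Set.range (e (n := n)))

/-- The positive roots `e_i - e_j`, `i < j`, of `A_{n-1}`. -/
def rootsA (n : ℕ) (p : {p : Fin n × Fin n // p.1 < p.2}) : WeightSpace n :=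
  e p.1.1 - e p.1.2

/-- The arithmetic characteristic polynomial of `A_{n-1}` in its weight lattice. -/
def charPolyWeightA (n : ℕ) : ℤ[X] :=
  charPoly (weightLattice n) (rootsA n)

/-- The multiset of the lengths of all cycles of `π`, fixed points counting as cycles of
length one. -/
def cycleLengths {n : ℕ} (π : Equiv.Perm (Fin n)) : Multiset ℕ :=
  π.partition.parts

/-- The permutations of `[n]` with exactly `k` cycles (fixed points included). -/
def permsWithCycles (n k : ℕ) : Finset (Equiv.Perm (Fin n)) :=
  {π | (cycleLengths π).card = k}

/-- `c_k`: the sum, over the permutations of `[n]` with `k` cycles, of the greatest common divisor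
of the cycle lengths. -/
def gcdSum (n k : ℕ) : ℕ :=
  ∑ π ∈ permsWithCycles n k, (cycleLengths π).gcd

end ArithTutte

end

/-! The term of a graph on `[n]` in the characteristic polynomial depends only on its partition into
connected components: the rank is `n` minus the number of components, and the multiplicity is the
greatest common divisor of their sizes. To see the latter, push everything forward along the map
summing the coordinates over each component. Its kernel is exactly the span of the roots in the
graph, so the index in question is that of the multiples of the integer vector `b` of component
sizes among all integer vectors on the line through `b`, which is the content `gcd b`.

It remains to compare signed sums over graphs and over permutations of a function of the induced set
partition. For each partition `s`, the sum of `(-1)^|B|` over the graphs `B` whose components refine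
`s`, and the sum of signs over the Young subgroup of `s`, are both `1` if `s` is discrete and `0`
otherwise. By induction on `s`, the sums over the graphs and over the permutations inducing exactly
`s` agree too. -/

namespace ArithTutte

section FiberSums

variable {L β γ M : Type*} [AddCommGroup M] [Fintype β] [Fintype γ]

theorem sum_smul_comp_eq_sum_fiber_smul [Fintype L] [DecidableEq L] {R : Type*} [Ring R]
    [Module R M] (P : β → L) (f : β → R) (w : L → M) :
    ∑ b, f b • w (P b) = ∑ s, (∑ b with P b = s, f b) • w s := by
  rw [← Finset.sum_fiberwise Finset.univ P]
  refine Finset.sum_congr rfl fun s _ => ?_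
  rw [Finset.sum_smul]
  exact Finset.sum_congr rfl fun b hb => by rw [(Finset.mem_filter.mp hb).2]

variable [PartialOrder L] [DecidableLE L]

theorem sum_filter_le_eq_add_sum_filter_lt [DecidableEq L] [DecidableLT L] (P : β → L)
    (f : β → M) (s : L) :
    ∑ b with P b ≤ s, f b = ∑ b with P b = s, f b + ∑ b with P b < s, f b := by
  classical
  rw [← Finset.sum_union (Finset.disjoint_filter.mpr fun _ _ h => h.not_lt), ← Finset.filter_or]
  simp only [le_iff_eq_or_lt]

theorem sum_fiber_eq_of_sum_le_eq [Finite L] [DecidableEq L] {P : β → L} {Q : γ → L}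
    {f : β → M} {g : γ → M}
    (h : ∀ s, ∑ b with P b ≤ s, f b = ∑ c with Q c ≤ s, g c) (s : L) :
    ∑ b with P b = s, f b = ∑ c with Q c = s, g c := by
  classical
  have := Fintype.ofFinite L
  induction s using WellFoundedLT.induction with
  | ind s ih =>
    have sum_lt : ∑ b with P b < s, f b = ∑ c with Q c < s, g c := by
      simpa [Finset.sum_fiberwise_eq_sum_filter] using
        Finset.sum_congr (rfl : Finset.univ.filter (· < s) = _) fun t ht =>
          ih t (Finset.mem_filter.mp ht).2
    have sum_le := h s
    rw [sum_filter_le_eq_add_sum_filter_lt, sum_filter_le_eq_add_sum_filter_lt, sum_lt] at sum_le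
    exact add_right_cancel sum_le

theorem sum_smul_comp_eq_of_sum_le_eq [Finite L] {R : Type*} [Ring R] [Module R M]
    {P : β → L} {Q : γ → L} {f : β → R} {g : γ → R}
    (h : ∀ s, ∑ b with P b ≤ s, f b = ∑ c with Q c ≤ s, g c) (w : L → M) :
    ∑ b, f b • w (P b) = ∑ c, g c • w (Q c) := by
  classical
  have := Fintype.ofFinite L
  rw [sum_smul_comp_eq_sum_fiber_smul P, sum_smul_comp_eq_sum_fiber_smul Q]
  exact Finset.sum_congr rfl fun s _ => by rw [sum_fiber_eq_of_sum_le_eq h]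

end FiberSums

section GraphsAndPermutations

variable {α : Type*}

instance [Finite α] : Finite (Setoid α) :=
  Finite.of_injective (fun s : Setoid α => s.r) fun _ _ h =>
    Setoid.ext fun a b => iff_of_eq (congrFun₂ h a b)

theorem exists_ne_rel_of_ne_bot {s : Setoid α} (hs : s ≠ ⊥) : ∃ i j, i ≠ j ∧ s i j := by
  contrapose! hs
  exact eq_bot_iff.mpr fun i j hij => not_not.mp fun hne => hs i j hne hij

/-- The edges of the complete graph on `α`, each given by its endpoints in increasing order;
a `Finset (Edge α)` is thus a graph on `α`. -/
abbrev Edge (α : Type*) [LT α] : Type _ := {p : α × α // p.1 < p.2}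

/-- The partition of the vertices into the connected components of the graph with edge set `B`. -/
def components [LT α] (B : Finset (Edge α)) : Setoid α :=
  Relation.EqvGen.setoid fun i j => ∃ p ∈ B, p.1 = (i, j)

theorem components_rel_of_mem [LT α] {B : Finset (Edge α)} {p : Edge α} (hp : p ∈ B) :
    components B p.1.1 p.1.2 :=
  Relation.EqvGen.rel _ _ ⟨p, hp, rfl⟩

theorem components_le_iff [LT α] {B : Finset (Edge α)} {s : Setoid α} :
    components B ≤ s ↔ ∀ p ∈ B, s p.1.1 p.1.2 := by
  refine ⟨fun h p hp => h (components_rel_of_mem hp), fun h => Setoid.eqvGen_le ?_⟩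
  rintro _ _ ⟨p, hp, hij⟩
  simpa [hij] using h p hp

open Classical in
theorem sum_neg_one_pow_card_of_components_le [Fintype α] [LinearOrder α] (s : Setoid α) :
    ∑ B : Finset (Edge α) with components B ≤ s, (-1 : ℤ) ^ B.card = if s = ⊥ then 1 else 0 := by
  set E : Finset (Edge α) := {p | s p.1.1 p.1.2}
  have graphs_within_blocks : Finset.univ.filter (components · ≤ s) = E.powerset := by
    ext B
    simp [E, components_le_iff, Finset.subset_iff]
  have empty_iff : E = ∅ ↔ s = ⊥ := by
    refine ⟨fun hE => ?_, ?_⟩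
    · by_contra hs
      obtain ⟨i, j, hne, hij⟩ := exists_ne_rel_of_ne_bot hs
      rcases hne.lt_or_gt with hlt | hlt
      · exact Finset.filter_eq_empty_iff.mp hE (Finset.mem_univ ⟨(i, j), hlt⟩) hij
      · exact Finset.filter_eq_empty_iff.mp hE (Finset.mem_univ ⟨(j, i), hlt⟩) (s.symm hij)
    · rintro rfl
      exact Finset.filter_eq_empty_iff.mpr fun p _ hp => p.2.ne hp
  rw [graphs_within_blocks, Finset.sum_powerset_neg_one_pow_card]
  exact if_congr empty_iff rfl rfl

/-- The Young subgroup of a set partition: the permutations preserving each block. -/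
def youngSubgroup (s : Setoid α) : Subgroup (Equiv.Perm α) where
  carrier := {π | ∀ x, s x (π x)}
  one_mem' := s.refl
  mul_mem' {π σ} hπ hσ x := s.trans (hσ x) (hπ (σ x))
  inv_mem' {π} hπ x := by simpa using s.symm (hπ (π⁻¹ x))

theorem youngSubgroup_bot : youngSubgroup (⊥ : Setoid α) = ⊥ := by
  refine (Subgroup.eq_bot_iff_forall _).mpr fun π hπ => Equiv.ext fun x => ?_
  exact (hπ x : x = π x).symm

theorem swap_mem_youngSubgroup [DecidableEq α] {s : Setoid α} {i j : α} (hij : s i j) :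
    Equiv.swap i j ∈ youngSubgroup s := by
  intro x
  rcases eq_or_ne x i with rfl | hi
  · simpa using hij
  rcases eq_or_ne x j with rfl | hj
  · simpa using s.symm hij
  · rw [Equiv.swap_apply_of_ne_of_ne hi hj]

theorem sameCycle_setoid_le_iff {π : Equiv.Perm α} {s : Setoid α} :
    Equiv.Perm.SameCycle.setoid π ≤ s ↔ π ∈ youngSubgroup s := by
  refine ⟨fun h x => h (Equiv.Perm.sameCycle_apply_right.mpr (.refl π x)), ?_⟩
  rintro h x _ ⟨k, rfl⟩
  exact (youngSubgroup s).zpow_mem h k x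

open Classical in
theorem sum_sign_of_sameCycle_le [Fintype α] (s : Setoid α) :
    ∑ π : Equiv.Perm α with Equiv.Perm.SameCycle.setoid π ≤ s, (Equiv.Perm.sign π : ℤ) =
      if s = ⊥ then 1 else 0 := by
  simp only [sameCycle_setoid_le_iff]
  split_ifs with hs
  · simp [hs, youngSubgroup_bot, Finset.filter_eq']
  · obtain ⟨i, j, hne, hij⟩ := exists_ne_rel_of_ne_bot hs
    let signHom : youngSubgroup s →* ℤ :=
      ((Units.coeHom ℤ).comp Equiv.Perm.sign).comp (youngSubgroup s).subtype
    have signHom_ne_one : signHom ≠ 1 := fun h => by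
      have := DFunLike.congr_fun h ⟨_, swap_mem_youngSubgroup hij⟩
      simp [signHom, Equiv.Perm.sign_swap hne] at this
    rw [← sum_hom_units_eq_zero signHom signHom_ne_one]
    exact Finset.sum_subtype _ (by simp) _

theorem sum_graph_eq_sum_perm [Fintype α] [LinearOrder α] {M : Type*} [AddCommGroup M]
    (w : Setoid α → M) :
    ∑ B : Finset (Edge α), (-1 : ℤ) ^ B.card • w (components B) =
      ∑ π : Equiv.Perm α, (Equiv.Perm.sign π : ℤ) • w (Equiv.Perm.SameCycle.setoid π) := by
  classical
  refine sum_smul_comp_eq_of_sum_le_eq (fun s => ?_) w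
  rw [sum_neg_one_pow_card_of_components_le]
  convert (sum_sign_of_sameCycle_le s).symm

end GraphsAndPermutations

section Blocks

variable {α : Type*} [Fintype α]

open Classical in
/-- The number of elements of a block of a set partition. -/
noncomputable def blockSize (s : Setoid α) (c : Quotient s) : ℕ :=
  Finset.card {i | Quotient.mk s i = c}

open Classical in
/-- The greatest common divisor of the sizes of the blocks of a set partition. -/
noncomputable def blockGcd (s : Setoid α) : ℕ :=
  Finset.univ.gcd (blockSize s)

theorem blockSize_pos (s : Setoid α) (c : Quotient s) : 0 < blockSize s c :=
  Finset.card_pos.mpr ⟨c.out, by simp⟩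

open Classical in
theorem sum_blockSize (s : Setoid α) : ∑ c, blockSize s c = Fintype.card α :=
  (Finset.card_eq_sum_card_fiberwise fun _ _ => Finset.mem_univ _).symm

end Blocks

section CycleLengths

theorem eq_filter_two_le_add_replicate_one {m : Multiset ℕ} (pos : ∀ k ∈ m, 0 < k) :
    m = m.filter (2 ≤ ·) + Multiset.replicate (m.sum - (m.filter (2 ≤ ·)).sum) 1 := by
  have rest : m.filter (¬ 2 ≤ ·) = Multiset.replicate (m.filter (¬ 2 ≤ ·)).card 1 := by
    refine Multiset.eq_replicate_card.mpr fun k hk => ?_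
    have := pos k (Multiset.mem_filter.mp hk).1
    have := (Multiset.mem_filter.mp hk).2
    omega
  have split := Multiset.filter_add_not (2 ≤ ·) m
  have card_rest : m.sum - (m.filter (2 ≤ ·)).sum = (m.filter (¬ 2 ≤ ·)).card := by
    have sum_split := congrArg Multiset.sum split
    have sum_rest := congrArg Multiset.sum rest
    rw [Multiset.sum_add] at sum_split
    rw [Multiset.sum_replicate, smul_eq_mul, mul_one] at sum_rest
    omega
  rw [card_rest, ← rest, split]

variable {α : Type*} [Fintype α] [DecidableEq α]

theorem blockSize_sameCycle_of_mem_support {π : Equiv.Perm α} {x : α} (hx : x ∈ π.support) :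
    blockSize (Equiv.Perm.SameCycle.setoid π) (Quotient.mk _ x) = (π.cycleOf x).support.card := by
  rw [blockSize]
  congr 1
  ext y
  rw [Equiv.Perm.mem_support_cycleOf_iff' (Equiv.Perm.mem_support.mp hx)]
  simpa using Quotient.eq.trans Equiv.Perm.sameCycle_comm

theorem two_le_blockSize_sameCycle_iff {π : Equiv.Perm α} {x : α} :
    2 ≤ blockSize (Equiv.Perm.SameCycle.setoid π) (Quotient.mk _ x) ↔ x ∈ π.support := by
  classical
  refine ⟨fun h => ?_, fun hx => ?_⟩
  · obtain ⟨y, hy, hyx⟩ := Finset.exists_mem_ne h x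
    have same_cycle : π.SameCycle y x := Quotient.exact (Finset.mem_filter.mp hy).2
    refine Equiv.Perm.mem_support.mpr fun hfix => hyx ?_
    exact (same_cycle.symm.eq_of_left hfix).symm
  · rw [blockSize_sameCycle_of_mem_support hx]
    exact (Equiv.Perm.isCycle_cycleOf π (Equiv.Perm.mem_support.mp hx)).two_le_card_support

open Classical in
theorem cycleType_eq_map_blockSize (π : Equiv.Perm α) :
    π.cycleType = (Finset.univ.filter
      (2 ≤ blockSize (Equiv.Perm.SameCycle.setoid π) ·)).val.map (blockSize _) := by
  set s := Equiv.Perm.SameCycle.setoid π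
  have two_le_iff (c : Quotient s) : 2 ≤ blockSize s c ↔ c.out ∈ π.support := by
    rw [← two_le_blockSize_sameCycle_iff, Quotient.out_eq]
  rw [Equiv.Perm.cycleType_def]
  refine (Multiset.map_eq_map_of_bij_of_nodup _ _ (Finset.nodup _) (Finset.nodup _)
    (fun c _ => π.cycleOf c.out) ?_ ?_ ?_ ?_).symm
  · intro c hc
    exact Equiv.Perm.cycleOf_mem_cycleFactorsFinset_iff.mpr
      ((two_le_iff c).mp (Finset.mem_filter.mp hc).2)
  · intro c hc d _ hcd
    have hc_out := (two_le_iff c).mp (Finset.mem_filter.mp hc).2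
    have mem_cycle : c.out ∈ (π.cycleOf c.out).support :=
      Equiv.Perm.mem_support_cycleOf_iff.mpr ⟨.refl _ _, hc_out⟩
    have hcd : π.cycleOf c.out = π.cycleOf d.out := hcd
    rw [hcd] at mem_cycle
    exact (Quotient.out_equiv_out.mp (Equiv.Perm.mem_support_cycleOf_iff.mp mem_cycle).1).symm
  · intro σ hσ
    obtain ⟨x, hx⟩ := (Equiv.Perm.mem_cycleFactorsFinset_iff.mp hσ).1.nonempty_support
    have hxπ := Equiv.Perm.mem_cycleFactorsFinset_support_le hσ hx
    refine ⟨Quotient.mk s x, ?_, ?_⟩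
    · exact Finset.mem_filter.mpr ⟨Finset.mem_univ _, two_le_blockSize_sameCycle_iff.mpr hxπ⟩
    · rw [Equiv.Perm.cycle_is_cycleOf hx hσ]
      exact Equiv.Perm.SameCycle.cycleOf_eq (Quotient.mk_out (s := s) x)
  · intro c hc
    have hc_out := (two_le_iff c).mp (Finset.mem_filter.mp hc).2
    simpa using blockSize_sameCycle_of_mem_support hc_out

open Classical in
theorem partition_parts_eq_map_blockSize (π : Equiv.Perm α) :
    π.partition.parts = Finset.univ.val.map (blockSize (Equiv.Perm.SameCycle.setoid π)) := by
  set sizes := Finset.univ.val.map (blockSize (Equiv.Perm.SameCycle.setoid π))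
  have sizes_pos : ∀ k ∈ sizes, 0 < k := fun k hk => by
    obtain ⟨c, -, rfl⟩ := Multiset.mem_map.mp hk
    exact blockSize_pos _ c
  have filter_sizes : sizes.filter (2 ≤ ·) = π.cycleType := by
    rw [cycleType_eq_map_blockSize, Multiset.filter_map, Finset.filter_val]
    rfl
  have sum_sizes : sizes.sum = Fintype.card α := sum_blockSize _
  rw [eq_filter_two_le_add_replicate_one sizes_pos, filter_sizes, sum_sizes, π.sum_cycleType,
    Equiv.Perm.parts_partition]

theorem card_partition_parts (π : Equiv.Perm α) :
    π.partition.parts.card = Nat.card (Quotient (Equiv.Perm.SameCycle.setoid π)) := by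
  classical
  rw [partition_parts_eq_map_blockSize, Multiset.card_map, Nat.card_eq_fintype_card]
  rfl

theorem gcd_partition_parts (π : Equiv.Perm α) :
    π.partition.parts.gcd = blockGcd (Equiv.Perm.SameCycle.setoid π) := by
  rw [partition_parts_eq_map_blockSize]
  rfl

theorem sign_eq_neg_one_pow_card_sub_card_parts (π : Equiv.Perm α) :
    Equiv.Perm.sign π = (-1) ^ (Fintype.card α - π.partition.parts.card) := by
  have support_le : π.support.card ≤ Fintype.card α := π.support.card_le_univ
  have cycles_le : π.cycleType.card * 2 ≤ π.support.card := by
    rw [← π.sum_cycleType, ← smul_eq_mul]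
    exact Multiset.card_nsmul_le_sum fun _ => Equiv.Perm.two_le_of_mem_cycleType
  rw [Equiv.Perm.sign_of_cycleType, Equiv.Perm.parts_partition, Multiset.card_add,
    Multiset.card_replicate, π.sum_cycleType]
  refine neg_one_pow_congr ?_
  grind

end CycleLengths

section EdgeVectors

variable {α : Type*} [DecidableEq α] [LT α] (R : Type*) [Ring R]

/-- The vector `δ_i - δ_j` of an edge `(i, j)`, a lift of a positive root to `R^α`. -/
def edgeVec (p : Edge α) : α → R :=
  Pi.single p.1.1 1 - Pi.single p.1.2 1

theorem single_sub_single_mem_span_edgeVec {B : Finset (Edge α)} {i j : α}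
    (hij : components B i j) :
    Pi.single i 1 - Pi.single j 1 ∈ Submodule.span R (edgeVec R '' (B : Set (Edge α))) := by
  induction hij with
  | rel i j h =>
    obtain ⟨p, hp, hpij⟩ := h
    exact Submodule.subset_span ⟨p, hp, by rw [edgeVec, hpij]⟩
  | refl i => simp
  | symm i j _ ih => simpa using Submodule.neg_mem _ ih
  | trans i j k _ _ ih_ij ih_jk => simpa using Submodule.add_mem _ ih_ij ih_jk

end EdgeVectors

section BlockSums

variable {α : Type*} [Fintype α]

section CommRing

variable (R : Type*) [CommRing R]

open Classical in
/-- The linear map sending a vector to its sums over the blocks of a set partition; its kernel is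
spanned by the edge vectors within the blocks. -/
noncomputable def blockSum (s : Setoid α) : (α → R) →ₗ[R] (Quotient s → R) :=
  LinearMap.pi fun c => ∑ i with Quotient.mk s i = c, LinearMap.proj i

open Classical in
theorem blockSum_apply (s : Setoid α) (x : α → R) (c : Quotient s) :
    blockSum R s x c = ∑ i with Quotient.mk s i = c, x i := by
  simp [blockSum]

theorem blockSum_single [DecidableEq α] (s : Setoid α) [DecidableEq (Quotient s)] (i : α)
    (a : R) : blockSum R s (Pi.single i a) = Pi.single (Quotient.mk s i) a := by
  ext c
  simp [blockSum_apply, Pi.single_apply, eq_comm]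

theorem blockSum_one (s : Setoid α) : blockSum R s 1 = fun c => (blockSize s c : R) := by
  ext c
  simp [blockSum_apply, blockSize]

theorem blockSum_one_ne_zero [Nonempty α] [CharZero R] (s : Setoid α) : blockSum R s 1 ≠ 0 := by
  intro h
  have := congrFun h (Quotient.mk s (Classical.arbitrary α))
  simp [blockSum_one, (blockSize_pos _ _).ne'] at this

theorem blockSum_intCast (s : Setoid α) (x : α → ℤ) :
    blockSum R s ((↑) ∘ x) = (↑) ∘ blockSum ℤ s x := by
  ext c
  simp [blockSum_apply]

theorem blockSum_surjective (s : Setoid α) : Function.Surjective (blockSum R s) := by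
  classical
  intro y
  refine ⟨∑ c, Pi.single c.out (y c), ?_⟩
  simp only [map_sum, blockSum_single, Quotient.out_eq, Finset.univ_sum_single]

variable {R}

theorem eq_sum_smul_single_sub_single_out [DecidableEq α] {s : Setoid α} {x : α → R}
    (hx : blockSum R s x = 0) :
    x = ∑ i, x i • (Pi.single i 1 - Pi.single (Quotient.mk s i).out 1 : α → R) := by
  classical
  have sum_out : ∑ i, x i • (Pi.single (Quotient.mk s i).out 1 : α → R) = 0 := by
    rw [sum_smul_comp_eq_sum_fiber_smul (Quotient.mk s) x fun c => Pi.single c.out 1]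
    refine Finset.sum_eq_zero fun c _ => ?_
    rw [← blockSum_apply, hx, Pi.zero_apply, zero_smul]
  simp only [smul_sub, Finset.sum_sub_distrib, sum_out, sub_zero]
  exact pi_eq_sum_univ' x

variable [DecidableEq α] [LT α]

variable (R) in
theorem span_edgeVec_eq_ker_blockSum (B : Finset (Edge α)) :
    Submodule.span R (edgeVec R '' (B : Set (Edge α))) =
      LinearMap.ker (blockSum R (components B)) := by
  classical
  apply le_antisymm
  · rw [Submodule.span_le]
    rintro _ ⟨p, hp, rfl⟩
    rw [SetLike.mem_coe, LinearMap.mem_ker, edgeVec, map_sub, blockSum_single, blockSum_single,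
      Quotient.sound (components_rel_of_mem hp), sub_self]
  · intro x hx
    rw [eq_sum_smul_single_sub_single_out hx]
    exact Submodule.sum_mem _ fun i _ => Submodule.smul_mem _ _
      (single_sub_single_mem_span_edgeVec R (Setoid.symm' _ (Quotient.mk_out i)))

variable {M : Type*} [AddCommGroup M] [Module R M] {f : (α → R) →ₗ[R] M}

theorem span_image_edgeVec (f : (α → R) →ₗ[R] M) (B : Finset (Edge α)) :
    Submodule.span R ((fun p => f (edgeVec R p)) '' (B : Set (Edge α))) =
      (LinearMap.ker (blockSum R (components B))).map f := by
  rw [← span_edgeVec_eq_ker_blockSum, Submodule.map_span, Set.image_image]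

theorem comap_span_image_edgeVec (hf : LinearMap.ker f = Submodule.span R {1})
    (B : Finset (Edge α)) :
    (Submodule.span R ((fun p => f (edgeVec R p)) '' (B : Set (Edge α)))).comap f =
      (Submodule.span R {blockSum R (components B) 1}).comap (blockSum R (components B)) := by
  have map_span_one : (Submodule.span R {1}).map (blockSum R (components B)) =
      Submodule.span R {blockSum R (components B) 1} := by
    rw [Submodule.map_span, Set.image_singleton]
  rw [span_image_edgeVec, Submodule.comap_map_eq, hf, ← map_span_one, Submodule.comap_map_eq,
    sup_comm]

end CommRing

theorem finrank_span_image_edgeVec [Nonempty α] [DecidableEq α] [LT α] {K V : Type*} [Field K]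
    [CharZero K] [AddCommGroup V] [Module K V] {f : (α → K) →ₗ[K] V}
    (hf : LinearMap.ker f = Submodule.span K {1}) (B : Finset (Edge α)) :
    Module.finrank K (Submodule.span K ((fun p => f (edgeVec K p)) '' (B : Set (Edge α)))) +
      Nat.card (Quotient (components B)) = Fintype.card α := by
  classical
  set bs := blockSum K (components B)
  have rank_nullity := LinearMap.finrank_range_add_finrank_ker bs
  rw [LinearMap.range_eq_top.mpr (blockSum_surjective K _), finrank_top, Module.finrank_pi,
    Module.finrank_pi] at rank_nullity
  have injective_on_ker : Function.Injective (f.domRestrict (LinearMap.ker bs)) := by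
    rw [LinearMap.injective_domRestrict_iff, hf]
    exact Submodule.disjoint_span_singleton_of_notMem (blockSum_one_ne_zero K _)
  rw [span_image_edgeVec, ← LinearMap.range_domRestrict,
    LinearMap.finrank_range_of_inj injective_on_ker, Nat.card_eq_fintype_card]
  omega

end BlockSums

section Saturation

theorem relIndex_comap_comap {G H : Type*} [AddGroup G] [AddGroup H] (f : G →+ H)
    (S : AddSubgroup H) {T : AddSubgroup H} (hT : T ≤ f.range) :
    (S.comap f).relIndex (T.comap f) = S.relIndex T := by
  rw [AddSubgroup.relIndex_comap, AddSubgroup.map_comap_eq_self hT]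

theorem relIndex_zmultiples_zsmul {G : Type*} [AddGroup G] {u : G}
    (hu : Function.Injective fun k : ℤ => k • u) (g : ℤ) :
    (AddSubgroup.zmultiples (g • u)).relIndex (AddSubgroup.zmultiples u) = g.natAbs := by
  have := AddSubgroup.relIndex_map_map_of_injective (f := zmultiplesHom G u)
    (AddSubgroup.zmultiples g) ⊤ hu
  rw [AddMonoidHom.map_zmultiples, ← AddMonoidHom.range_eq_map, AddSubgroup.relIndex_top_right,
    Int.index_zmultiples] at this
  exact this

theorem gcd_natCast {ι : Type*} (s : Finset ι) (f : ι → ℕ) :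
    (s.gcd fun i => (f i : ℤ)) = s.gcd f := by
  classical
  induction s using Finset.induction_on with
  | empty => simp
  | insert i s _ ih => rw [Finset.gcd_insert, Finset.gcd_insert, ih]; rfl

variable {ι : Type*} (K : Type*) [Field K]

/-- The integer vectors on the line spanned by `b` over the field `K`; in characteristic zero and
for `b ≠ 0` this is the saturation of `ℤb`, whatever the field. -/
def integerLine (b : ι → ℤ) : AddSubgroup (ι → ℤ) :=
  (Submodule.span K {((↑) ∘ b : ι → K)}).toAddSubgroup.comap ((Int.castAddHom K).compLeft ι)

theorem mem_integerLine {b x : ι → ℤ} :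
    x ∈ integerLine K b ↔ ∃ t : K, ∀ i, t * b i = x i := by
  simp [integerLine, Submodule.mem_span_singleton, funext_iff]

variable [CharZero K] [Fintype ι]

theorem integerLine_eq_zmultiples_of_gcd_eq_one {u : ι → ℤ} (hu : Finset.univ.gcd u = 1) :
    integerLine K u = AddSubgroup.zmultiples u := by
  obtain ⟨l, hl⟩ := Finset.gcd_eq_sum_mul Finset.univ u
  ext x
  rw [mem_integerLine, AddSubgroup.mem_zmultiples_iff]
  refine ⟨?_, ?_⟩
  · rintro ⟨t, ht⟩
    have t_eq : t = (∑ i, x i * l i : ℤ) := by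
      have bezout : (1 : K) = ∑ i, (u i : K) * l i := by exact_mod_cast hu.symm.trans hl
      rw [← mul_one t, bezout, Finset.mul_sum]
      push_cast
      exact Finset.sum_congr rfl fun i _ => by rw [← ht, mul_assoc]
    refine ⟨∑ i, x i * l i, funext fun i => ?_⟩
    have := ht i
    rw [t_eq] at this
    exact_mod_cast this
  · rintro ⟨k, rfl⟩
    exact ⟨k, by simp⟩

theorem relIndex_zmultiples_integerLine {b : ι → ℤ} (hb : b ≠ 0) :
    (AddSubgroup.zmultiples b).relIndex (integerLine K b) = (Finset.univ.gcd b).natAbs := by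
  obtain ⟨i, -⟩ := Function.ne_iff.mp hb
  obtain ⟨u, hbu, hu⟩ := Finset.extract_gcd b ⟨i, Finset.mem_univ i⟩
  set g := Finset.univ.gcd b
  have b_eq : b = g • u := funext fun i => hbu i (Finset.mem_univ i)
  have g_ne_zero : g ≠ 0 := fun hg => hb (by rw [b_eq, hg, zero_smul])
  have cast_b_eq : ((↑) ∘ b : ι → K) = (g : K) • ((↑) ∘ u) := by
    ext i
    simp [b_eq]
  have line_eq : integerLine K b = integerLine K u := by
    rw [integerLine, integerLine, cast_b_eq,
      Submodule.span_singleton_smul_eq (Int.cast_ne_zero.mpr g_ne_zero).isUnit]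
  have u_ne_zero : u ≠ 0 := fun h => hb (by rw [b_eq, h, smul_zero])
  rw [line_eq, integerLine_eq_zmultiples_of_gcd_eq_one K hu, b_eq,
    relIndex_zmultiples_zsmul (smul_left_injective ℤ u_ne_zero)]

end Saturation

section WeightLattice

/-- The map `ℤⁿ → ℝⁿ / ℝ(1, …, 1)` with `e_i` as the image of the `i`-th basis vector; its image
is the weight lattice. -/
noncomputable def latticeMap (n : ℕ) : (Fin n → ℤ) →ₗ[ℤ] WeightSpace n :=
  Fintype.linearCombination ℤ (e (n := n))

variable {n : ℕ}

theorem range_latticeMap : LinearMap.range (latticeMap n) = weightLattice n :=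
  Fintype.range_linearCombination ℤ e

theorem latticeMap_apply (x : Fin n → ℤ) :
    latticeMap n x = (Submodule.span ℝ {fun _ => 1}).mkQ ((↑) ∘ x) := by
  rw [latticeMap, Fintype.linearCombination_apply, pi_eq_sum_univ' ((↑) ∘ x : Fin n → ℝ), map_sum]
  refine Finset.sum_congr rfl fun i _ => ?_
  rw [map_smul, Function.comp_apply, Int.cast_smul_eq_zsmul]
  rfl

theorem ker_latticeMap [NeZero n] : LinearMap.ker (latticeMap n) = Submodule.span ℤ {1} := by
  ext x
  rw [LinearMap.mem_ker, latticeMap_apply, ← LinearMap.mem_ker, Submodule.ker_mkQ,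
    Submodule.mem_span_singleton, Submodule.mem_span_singleton]
  refine ⟨?_, ?_⟩
  · rintro ⟨t, ht⟩
    have t_eq : t = x 0 := by simpa using congrFun ht 0
    refine ⟨x 0, funext fun i => ?_⟩
    have x_eq : (x 0 : ℝ) = x i := by simpa [t_eq] using congrFun ht i
    simpa using Int.cast_injective x_eq
  · rintro ⟨k, rfl⟩
    exact ⟨k, by ext i; simp⟩

theorem finrank_weightLattice [NeZero n] : Module.finrank ℤ (weightLattice n) = n - 1 := by
  have rank_nullity := Submodule.finrank_quotient_add_finrank (LinearMap.ker (latticeMap n))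
  have finrank_ker : Module.finrank ℤ (Submodule.span ℤ {(1 : Fin n → ℤ)}) = 1 :=
    (LinearEquiv.toSpanNonzeroSingleton ℤ _ _ one_ne_zero).finrank_eq.symm.trans
      (Module.finrank_self ℤ)
  rw [(latticeMap n).quotKerEquivRange.finrank_eq, range_latticeMap, ker_latticeMap,
    finrank_ker, Module.finrank_fin_fun] at rank_nullity
  omega

theorem rootsA_eq_mkQ : rootsA n = fun p => (Submodule.span ℝ {fun _ => 1}).mkQ (edgeVec ℝ p) := by
  ext p
  rw [edgeVec, map_sub]
  rfl

theorem rootsA_eq_latticeMap : rootsA n = fun p => latticeMap n (edgeVec ℤ p) := by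
  ext p
  simp [rootsA, edgeVec, latticeMap, Fintype.linearCombination_apply_single]

theorem rank_rootsA_add_card [NeZero n] (B : Finset (Edge (Fin n))) :
    rank (rootsA n) B + Nat.card (Quotient (components B)) = n := by
  rw [rank, rootsA_eq_mkQ, finrank_span_image_edgeVec (Submodule.ker_mkQ _), Fintype.card_fin]

theorem latticeMap_mem_span_real_rootsA_iff {B : Finset (Edge (Fin n))} {x : Fin n → ℤ} :
    latticeMap n x ∈ Submodule.span ℝ (rootsA n '' (B : Set (Edge (Fin n)))) ↔
      blockSum ℤ (components B) x ∈ integerLine ℝ (blockSum ℤ (components B) 1) := by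
  rw [latticeMap_apply, ← Submodule.mem_comap, rootsA_eq_mkQ,
    comap_span_image_edgeVec (Submodule.ker_mkQ _), Submodule.mem_comap]
  have cast_one : (1 : Fin n → ℝ) = (↑) ∘ (1 : Fin n → ℤ) := by ext i; simp
  rw [cast_one, blockSum_intCast, blockSum_intCast]
  rfl

theorem latticeMap_mem_span_int_rootsA_iff [NeZero n] {B : Finset (Edge (Fin n))}
    {x : Fin n → ℤ} :
    latticeMap n x ∈ Submodule.span ℤ (rootsA n '' (B : Set (Edge (Fin n)))) ↔
      blockSum ℤ (components B) x ∈
        AddSubgroup.zmultiples (blockSum ℤ (components B) 1) := by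
  rw [← Submodule.mem_comap, rootsA_eq_latticeMap, comap_span_image_edgeVec ker_latticeMap,
    Submodule.mem_comap, Submodule.mem_span_singleton, AddSubgroup.mem_zmultiples_iff]

theorem latticeMult_rootsA [NeZero n] (B : Finset (Edge (Fin n))) :
    latticeMult (weightLattice n) (rootsA n) B = blockGcd (components B) := by
  classical
  set S := (Submodule.span ℤ (rootsA n '' (B : Set (Edge (Fin n))))).toAddSubgroup
  set T := ((Submodule.span ℝ (rootsA n '' (B : Set (Edge (Fin n))))).restrictScalars ℤ ⊓
    weightLattice n).toAddSubgroup
  set f := (latticeMap n).toAddMonoidHom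
  set bs := (blockSum ℤ (components B)).toAddMonoidHom
  have T_le_range : T ≤ f.range := fun v hv => (range_latticeMap.ge hv.2 :)
  have comap_S : S.comap f = (AddSubgroup.zmultiples (bs 1)).comap bs := by
    ext x
    exact latticeMap_mem_span_int_rootsA_iff
  have comap_T : T.comap f = (integerLine ℝ (bs 1)).comap bs := by
    ext x
    have mem_lattice : latticeMap n x ∈ weightLattice n := range_latticeMap.le ⟨x, rfl⟩
    exact (and_iff_left mem_lattice).trans latticeMap_mem_span_real_rootsA_iff
  have bs_range : bs.range = ⊤ := AddMonoidHom.range_eq_top.mpr (blockSum_surjective ℤ _)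
  calc S.relIndex T
    _ = (S.comap f).relIndex (T.comap f) := (relIndex_comap_comap f S T_le_range).symm
    _ = (AddSubgroup.zmultiples (bs 1)).relIndex (integerLine ℝ (bs 1)) := by
      rw [comap_S, comap_T, relIndex_comap_comap _ _ (bs_range ▸ le_top)]
    _ = (Finset.univ.gcd (bs 1)).natAbs :=
      relIndex_zmultiples_integerLine ℝ (blockSum_one_ne_zero ℤ _)
    _ = blockGcd (components B) := by
      rw [LinearMap.toAddMonoidHom_coe, blockSum_one, gcd_natCast, Int.natAbs_natCast, blockGcd]

end WeightLattice

section CharacteristicPolynomial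

variable {V ι : Type*} [AddCommGroup V] [Module ℝ V]

theorem rank_le_card (a : ι → V) (B : Finset ι) : rank a B ≤ B.card := by
  classical
  rw [rank, ← Finset.coe_image]
  exact (finrank_span_finset_le_card _).trans Finset.card_image_le

variable [Fintype ι]

theorem rank_le_rank_univ (a : ι → V) (B : Finset ι) : rank a B ≤ rank a Finset.univ := by
  have : FiniteDimensional ℝ (Submodule.span ℝ (a '' (Finset.univ : Finset ι))) :=
    FiniteDimensional.span_of_finite ℝ (Set.toFinite _)
  exact Submodule.finrank_mono (Submodule.span_mono (Set.image_mono (by simp)))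

theorem charPoly_eq_sum {L : Submodule ℤ V} {a : ι → V}
    (h : rank a Finset.univ ≤ Module.finrank ℤ L) :
    charPoly L a = ∑ B : Finset ι, (-1 : ℤ) ^ B.card •
      ((latticeMult L a B : ℤ[X]) * Polynomial.X ^ (Module.finrank ℤ L - rank a B)) := by
  rw [charPoly, tutte, map_sum, Finset.mul_sum]
  refine Finset.sum_congr rfl fun B _ => ?_
  have rank_le := rank_le_rank_univ a B
  have le_card := rank_le_card a B
  set r := rank a Finset.univ
  have X_pow_eq : (Polynomial.X : ℤ[X]) ^ (Module.finrank ℤ L - rank a B) =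
      Polynomial.X ^ (Module.finrank ℤ L - r) * Polynomial.X ^ (r - rank a B) := by
    rw [← pow_add]
    congr 1
    omega
  have sign_eq : (-1 : ℤ[X]) ^ B.card =
      (-1) ^ r * (-1) ^ (r - rank a B) * (-1) ^ (B.card - rank a B) := by
    rw [← pow_add, ← pow_add]
    exact neg_one_pow_congr (by grind)
  simp only [map_mul, map_pow, map_sub, map_one, map_natCast, MvPolynomial.aeval_X,
    Matrix.cons_val_zero, Matrix.cons_val_one, zero_sub, sub_sub_cancel_left, zsmul_eq_mul,
    Int.cast_pow, Int.cast_neg, Int.cast_one]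
  rw [neg_pow (Polynomial.X : ℤ[X]), X_pow_eq, sign_eq]
  ring

end CharacteristicPolynomial

section TypeA

variable {n : ℕ} [NeZero n]

theorem charPolyWeightA_eq_sum_graph :
    charPolyWeightA n = ∑ B : Finset (Edge (Fin n)), (-1 : ℤ) ^ B.card •
      ((blockGcd (components B) : ℤ[X]) *
        Polynomial.X ^ (Nat.card (Quotient (components B)) - 1)) := by
  have components_pos (B : Finset (Edge (Fin n))) : 0 < Nat.card (Quotient (components B)) :=
    Nat.card_pos
  have rank_univ_le : rank (rootsA n) Finset.univ ≤ Module.finrank ℤ (weightLattice n) := by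
    have := rank_rootsA_add_card (n := n) Finset.univ
    have := components_pos Finset.univ
    rw [finrank_weightLattice]
    omega
  rw [charPolyWeightA, charPoly_eq_sum rank_univ_le]
  refine Finset.sum_congr rfl fun B _ => ?_
  have exponent_eq : n - 1 - rank (rootsA n) B = Nat.card (Quotient (components B)) - 1 := by
    have := rank_rootsA_add_card B
    omega
  rw [latticeMult_rootsA, finrank_weightLattice, exponent_eq]

theorem charPolyWeightA_eq_sum_perm :
    charPolyWeightA n = ∑ π : Equiv.Perm (Fin n),
      (-1) ^ (n - (cycleLengths π).card) * ((cycleLengths π).gcd : ℤ[X]) *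
        Polynomial.X ^ ((cycleLengths π).card - 1) := by
  rw [charPolyWeightA_eq_sum_graph, sum_graph_eq_sum_perm fun s =>
    (blockGcd s : ℤ[X]) * Polynomial.X ^ (Nat.card (Quotient s) - 1)]
  refine Finset.sum_congr rfl fun π _ => ?_
  rw [cycleLengths, sign_eq_neg_one_pow_card_sub_card_parts, gcd_partition_parts,
    card_partition_parts, Fintype.card_fin]
  simp [mul_assoc]

theorem card_cycleLengths_mem_Icc (π : Equiv.Perm (Fin n)) :
    (cycleLengths π).card ∈ Finset.Icc 1 n := by
  have card_le := Nat.card_le_card_of_surjective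
    (Quotient.mk (Equiv.Perm.SameCycle.setoid π)) Quotient.mk_surjective
  rw [Nat.card_fin] at card_le
  rw [cycleLengths, card_partition_parts, Finset.mem_Icc]
  exact ⟨Nat.card_pos, card_le⟩

end TypeA

end ArithTutte

theorem theorem5p3 (n : ℕ) (hn : 1 ≤ n) :
    ArithTutte.charPolyWeightA n =
      ∑ k ∈ Finset.Icc 1 n,
        (-1) ^ (n - k) * (ArithTutte.gcdSum n k : ℤ[X]) * Polynomial.X ^ (k - 1) := by
  have : NeZero n := ⟨by omega⟩
  rw [ArithTutte.charPolyWeightA_eq_sum_perm,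
    ← Finset.sum_fiberwise_of_maps_to fun π _ => ArithTutte.card_cycleLengths_mem_Icc π]
  refine Finset.sum_congr rfl fun k _ => ?_
  rw [ArithTutte.gcdSum, ArithTutte.permsWithCycles, Nat.cast_sum, Finset.mul_sum, Finset.sum_mul]
  refine Finset.sum_congr rfl fun π hπ => ?_
  rw [(Finset.mem_filter.mp hπ).2]
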